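/- Let $\mathbb F_{q^m}/\mathbb F_q$ be an extension of finite fields, $\theta$ an automorphism of $\mathbb F_{q^m}$ with fixed field $\mathbb F_q$, and $\delta$ an additive map on $\mathbb F_{q^m}$ with $\delta(ab)=\delta(a)b+\theta(a)\delta(b)$. Let $\mathbb F_{q^m}[x;\theta,\delta]$ be the skew-polynomial ring with $xa=\theta(a)x+\delta(a)$. For $a,b\in\mathbb F_{q^m}$ put $\mathcal D_a(b)=\theta(b)a+\delta(b)$, and evaluate $f=\sum_i f_ix^i$ at $b$ with parameter $a$ as $f(b)_a=\sum_i f_i\mathcal D_a^i(b)$. Elements $a,a'$ are conjugate if $a'=\theta(c)ac^{-1}+\delta(c)c^{-1}$ for some $c\ne 0$. Let $n=n_1+\dots+n_\ell$ with all $n_i>0$, let $s\ge1$ and $k\ge 0$. Let $\boldsymbol\xi=(\xi_1,\dots,\xi_\ell)\in\mathbb F_{q^m}^\ell$ have pairwise non-conjugate entries, each with $\{c:\theta(c)\xi_i+\delta(c)=\xi_ic\}=\mathbb F_q$ (for $\delta=0$ and $\theta\neq\mathrm{id}$ this means $\xi_i\ne0$). For $j=1,\dots,s$ let $\boldsymbol\beta_j=(\boldsymbol\beta_j^{(1)}\mid\dots\mid\boldsymbol\beta_j^{(\ell)})\in\mathbb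 F_{q^m}^n$, where the $n_i$ entries of $\boldsymbol\beta_j^{(i)}$ are $\mathbb F_q$-linearly independent. For a vector $\boldsymbol x\in\mathbb F_{q^m}^{N}$ divided into $\ell$ blocks, the Moore matrix $\mathfrak M_d(\boldsymbol x)_{\boldsymbol\xi}\in\mathbb F_{q^m}^{d\times N}$ has the rows $r=0,\dots,d-1$ whose entry in a column belonging to block $i$ is $\mathcal D_{\xi_i}^r$ of the corresponding entry of $\boldsymbol x$. The linearized Reed–Solomon (LRS) code $\mathrm{LRS}_j[k]\subseteq\mathbb F_{q^m}^n$ consists of the vectors $\boldsymbol c_j(f)=\big(f(\boldsymbol\beta_j^{(1)})_{\xi_1}\mid\dots\mid f(\boldsymbol\beta_j^{(\ell)})_{\xi_\ell}\big)$ (entrywise evaluation) with $\deg f<k$, and the horizontally interleaved code $\mathrm{HILRS}[sk]$ consists of all $(\boldsymbol c_1\mid\dots\mid\boldsymbol c_s)\in\mathbb F_{q^m}^{sn}$ with $\boldsymbol c_j\in\mathrm{LRS}_j[k]$. Let $\boldsymbol y=\boldsymbol c+\boldsymbol e$, where $\boldsymbol c=(\boldsymbol c_1(f_1)\mid\dots\mid\boldsymbol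 c_s(f_s))\in\mathrm{HILRS}[sk]$ with $\deg f_j<k$, and where $\boldsymbol e=(\boldsymbol e_1\mid\dots\mid\boldsymbol e_s)$ has sum-rank weight $\sum_{i=1}^\ell t_i=t\le n-k$. Here $t_i$ is the $\mathbb F_q$-rank of $(\boldsymbol e_1^{(i)}\mid\dots\mid\boldsymbol e_s^{(i)})$, i.e. the maximal number of its $\mathbb F_q$-linearly independent entries. Let $\boldsymbol e=\boldsymbol a\boldsymbol B$, where $\boldsymbol a=(\boldsymbol a^{(1)}\mid\dots\mid\boldsymbol a^{(\ell)})$, the $t_i$ entries of $\boldsymbol a^{(i)}\in\mathbb F_{q^m}^{t_i}$ are $\mathbb F_q$-linearly independent, $\boldsymbol B=(\boldsymbol B_1\mid\dots\mid\boldsymbol B_s)\in\mathbb F_q^{t\times sn}$, $\boldsymbol B_j=\mathrm{diag}(\boldsymbol B_j^{(1)},\dots,\boldsymbol B_j^{(\ell)})$ with $\boldsymbol B_j^{(i)}\in\mathbb F_q^{t_i\times n_i}$, and $\mathrm{rk}_q(\boldsymbol B_1^{(i)}\mid\dots\mid\boldsymbol B_s^{(i)})=t_i$ for all $i$. Define $\boldsymbol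 M$ by $$\boldsymbol M^\top=\begin{pmatrix}\mathfrak M_{t+k}(\boldsymbol\beta_1)_{\boldsymbol\xi}^\top&&&-\mathfrak M_{t+1}(\boldsymbol y_1)_{\boldsymbol\xi}^\top\\&\ddots&&\vdots\\&&\mathfrak M_{t+k}(\boldsymbol\beta_s)_{\boldsymbol\xi}^\top&-\mathfrak M_{t+1}(\boldsymbol y_s)_{\boldsymbol\xi}^\top\end{pmatrix},$$ and let $\boldsymbol H$ be a parity-check matrix of $\mathrm{HILRS}[s(k+t)]$, i.e. a matrix over $\mathbb F_{q^m}$ with linearly independent rows and $\{\boldsymbol x:\boldsymbol H\boldsymbol x^\top=\boldsymbol 0\}=\mathrm{HILRS}[s(k+t)]$ (for instance $\boldsymbol H=\mathrm{diag}(\boldsymbol H_1,\dots,\boldsymbol H_s)$ with $\boldsymbol H_j$ a parity-check matrix of $\mathrm{LRS}_j[k+t]$). Then: 1. $\mathrm{rk}_{q^m}(\boldsymbol M)=(s+1)t+sk$ if and only if $\mathrm{rk}_{q^m}(\boldsymbol B\boldsymbol H^\top)=t$. 2. $\mathrm{rk}_{q^m}(\boldsymbol M)=(s+1)t+sk$ if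 and only if the solution space of $\boldsymbol M^\top\boldsymbol v=\boldsymbol 0$ is one-dimensional over $\mathbb F_{q^m}$. 3. If $\mathrm{rk}_{q^m}(\boldsymbol M)=(s+1)t+sk$, then decoding is correct: for every nonzero solution $\boldsymbol v$, read as the coefficient vectors of skew polynomials $p_1,\dots,p_s$ of degree $<t+k$ and $\tilde\sigma$ of degree $\le t$, the decoder that performs the left divisions $p_j=\tilde\sigma\cdot\tilde f_j+r_j$ with $\deg r_j<\deg\tilde\sigma$, declares a failure if some $r_j\ne0$ or some $\deg\tilde f_j\ge k$, and otherwise returns $(\tilde f_1,\dots,\tilde f_s)$, returns exactly $(f_1,\dots,f_s)$. -/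

import Mathlib

open Polynomial

namespace HILRS

/-! Conventions. `K` is the field with `q` elements and `F` its extension of degree `m`; `θ` is an
automorphism of `F` and `δ` an additive map. A vector of length `n = n₁ + ⋯ + n_ℓ` with blocks of
lengths `n i` is indexed by `Σ i, Fin (n i)`. A horizontally `s`-interleaved vector
`(x₁ | ⋯ | x_s)` is indexed by `(Σ i, Fin (n i)) × Fin s`; its coordinate at `(p, j)` is the `p`-th
coordinate of the component `x_j`. -/

section Skew

variable {F : Type*} [Field F]

/-- `δ` is a `θ`-derivation (additivity is part of the type of `δ`). -/
def IsDerivation (θ : F ≃+* F) (δ : F →+ F) : Prop :=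
  ∀ a b : F, δ (a * b) = δ a * b + θ a * δ b

/-- `(θ, δ)`-conjugacy: `b = θ(c) a c⁻¹ + δ(c) c⁻¹` for some nonzero `c`. -/
def Conj (θ : F ≃+* F) (δ : F →+ F) (a b : F) : Prop :=
  ∃ c : F, c ≠ 0 ∧ b = θ c * a * c⁻¹ + δ c * c⁻¹

/-- The set of the `c` that fix `a` under conjugation, with `0` added:
`θ(c) a + δ(c) = a c`. -/
def centralizer (θ : F ≃+* F) (δ : F →+ F) (a : F) : Set F :=
  {c : F | θ c * a + δ c = a * c}

/-- The operator `D_a(b) = θ(b) a + δ(b)`. -/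
def op (θ : F ≃+* F) (δ : F →+ F) (a b : F) : F := θ b * a + δ b

/-- Left multiplication by `x` in the skew-polynomial ring `F[x; θ, δ]`:
`x · ∑ b_j x^j = ∑ (θ(b_j) x^(j+1) + δ(b_j) x^j)`.
Skew polynomials are formal polynomials with coefficients on the left, so `F[X]` serves as the
underlying set (with its addition, coefficients and degree); the skew product is `skewMul`. -/
noncomputable def xMul (θ : F ≃+* F) (δ : F →+ F) (g : F[X]) : F[X] :=
  g.sum fun j b => monomial (j + 1) (θ b) + monomial j (δ b)

/-- The product of `F[x; θ, δ]`: `(∑ a_i x^i) · g = ∑ a_i (x^i · g)`, which is the product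
determined by the rule `x b = θ(b) x + δ(b)`. -/
noncomputable def skewMul (θ : F ≃+* F) (δ : F →+ F) (f g : F[X]) : F[X] :=
  f.sum fun i a => C a * (xMul θ δ)^[i] g

theorem skewMul_X_C (θ : F ≃+* F) (δ : F →+ F) (b : F) :
    skewMul θ δ X (C b) = C (θ b) * X + C (δ b) := by
  unfold skewMul
  rw [sum_X_index (by simp)]
  simp [xMul, sum_C_index, ← C_mul_X_eq_monomial]

/-- Generalized operator evaluation of the skew polynomial `f` at the point `b` with respect to
the evaluation parameter `a`: `∑ f_i D_a^i(b)`. -/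
noncomputable def opEval (θ : F ≃+* F) (δ : F →+ F) (f : F[X]) (b a : F) : F :=
  f.sum fun i c => c * (op θ δ a)^[i] b

/-- Left division of `p` by `d` with quotient `u` and remainder `r`:
`p = d · u + r` in `F[x; θ, δ]` and `deg r < deg d`. -/
def IsLeftDivision (θ : F ≃+* F) (δ : F →+ F) (p d u r : F[X]) : Prop :=
  p = skewMul θ δ d u + r ∧ r.degree < d.degree

variable {ℓ : ℕ} {n : Fin ℓ → ℕ}

/-- The generalized Moore matrix with `d` rows. -/
def moore (θ : F ≃+* F) (δ : F →+ F) (ξ : Fin ℓ → F) (d : ℕ) (x : (Σ i, Fin (n i)) → F) :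
    Matrix (Fin d) (Σ i, Fin (n i)) F :=
  Matrix.of fun r p => (op θ δ (ξ p.1))^[(r : ℕ)] (x p)

/-- The codeword of the message polynomial `f` for the code locators `β` and evaluation
parameters `ξ`. -/
noncomputable def encode (θ : F ≃+* F) (δ : F →+ F) (ξ : Fin ℓ → F)
    (β : (Σ i, Fin (n i)) → F) (f : F[X]) : (Σ i, Fin (n i)) → F :=
  fun p => opEval θ δ f (β p) (ξ p.1)

/-- The linearized Reed-Solomon code: all evaluations of skew polynomials of degree `< k`. -/
def lrsCode (θ : F ≃+* F) (δ : F →+ F) (ξ : Fin ℓ → F) (β : (Σ i, Fin (n i)) → F) (k : ℕ) :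
    Set ((Σ i, Fin (n i)) → F) :=
  {c | ∃ f : F[X], f.degree < k ∧ c = encode θ δ ξ β f}

/-- The `j`-th component of an interleaved vector. -/
def component {s : ℕ} (x : (Σ i, Fin (n i)) × Fin s → F) (j : Fin s) : (Σ i, Fin (n i)) → F :=
  fun p => x (p, j)

/-- The horizontally interleaved code whose `j`-th component code is the linearized Reed-Solomon
code with code locators `β j` (and skew polynomials of degree `< k`). -/
def hilrsCode {s : ℕ} (θ : F ≃+* F) (δ : F →+ F) (ξ : Fin ℓ → F)
    (β : Fin s → (Σ i, Fin (n i)) → F) (k : ℕ) : Set ((Σ i, Fin (n i)) × Fin s → F) :=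
  {c | ∀ j, component c j ∈ lrsCode θ δ ξ (β j) k}

/-- The codeword `c(f) = (c₁(f₁) | ⋯ | c_s(f_s))` of a message-polynomial vector. -/
noncomputable def hilrsEncode {s : ℕ} (θ : F ≃+* F) (δ : F →+ F) (ξ : Fin ℓ → F)
    (β : Fin s → (Σ i, Fin (n i)) → F) (f : Fin s → F[X]) : (Σ i, Fin (n i)) × Fin s → F :=
  fun x => encode θ δ ξ (β x.2) (f x.2) x.1

/-- `H` is a parity-check matrix of the code `C`: its rows are linearly independent and
`C = {x | H xᵀ = 0}`. -/
def IsParityCheck {ρ ι : Type*} [Fintype ι] (H : Matrix ρ ι F) (C : Set (ι → F)) : Prop :=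
  LinearIndependent F H.row ∧ ∀ x, x ∈ C ↔ H.mulVec x = 0

/-- The coefficient matrix `Mᵀ` of the linear system of the decoder. The unknowns are the
coefficients of `p₁, …, p_s` (degree `< t + k`) and those of `σ` (degree `≤ t`). -/
def gaoMatrixT {s : ℕ} (θ : F ≃+* F) (δ : F →+ F) (ξ : Fin ℓ → F)
    (β : Fin s → (Σ i, Fin (n i)) → F) (k t : ℕ) (y : (Σ i, Fin (n i)) × Fin s → F) :
    Matrix ((Σ i, Fin (n i)) × Fin s) ((Fin (t + k) × Fin s) ⊕ Fin (t + 1)) F :=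
  Matrix.fromCols
    (Matrix.blockDiagonal fun j => (moore θ δ ξ (t + k) (β j)).transpose)
    (Matrix.of fun x r => -(moore θ δ ξ (t + 1) (component y x.2)).transpose x.1 r)

/-- The matrix `M` of the linear system. -/
def gaoMatrix {s : ℕ} (θ : F ≃+* F) (δ : F →+ F) (ξ : Fin ℓ → F)
    (β : Fin s → (Σ i, Fin (n i)) → F) (k t : ℕ) (y : (Σ i, Fin (n i)) × Fin s → F) :
    Matrix ((Fin (t + k) × Fin s) ⊕ Fin (t + 1)) ((Σ i, Fin (n i)) × Fin s) F :=
  (gaoMatrixT θ δ ξ β k t y).transpose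

/-- The solution space of the homogeneous system `Mᵀ v = 0`. -/
def solutionSpace {s : ℕ} (θ : F ≃+* F) (δ : F →+ F) (ξ : Fin ℓ → F)
    (β : Fin s → (Σ i, Fin (n i)) → F) (k t : ℕ) (y : (Σ i, Fin (n i)) × Fin s → F) :
    Submodule F ((Fin (t + k) × Fin s) ⊕ Fin (t + 1) → F) :=
  LinearMap.ker (gaoMatrixT θ δ ξ β k t y).mulVecLin

/-- The polynomial `p_j` read off from a vector of unknowns. -/
noncomputable def solP {s k t : ℕ} (v : (Fin (t + k) × Fin s) ⊕ Fin (t + 1) → F) (j : Fin s) :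
    F[X] :=
  ∑ i : Fin (t + k), monomial (i : ℕ) (v (Sum.inl (i, j)))

/-- The polynomial `σ` read off from a vector of unknowns. -/
noncomputable def solSigma {s k t : ℕ} (v : (Fin (t + k) × Fin s) ⊕ Fin (t + 1) → F) : F[X] :=
  ∑ i : Fin (t + 1), monomial (i : ℕ) (v (Sum.inr i))

/-- `DecoderReturns θ δ k v out`: the decoder, having found the solution `v` of the linear system,
divides each `p_j` by `σ` on the left and returns `out`. Here `none` is the declaration of a
decoding failure, made if some remainder is nonzero or some quotient has degree at least `k`;
otherwise the vector of quotients is returned. -/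
def DecoderReturns {s t : ℕ} (θ : F ≃+* F) (δ : F →+ F) (k : ℕ)
    (v : (Fin (t + k) × Fin s) ⊕ Fin (t + 1) → F) (out : Option (Fin s → F[X])) : Prop :=
  ∃ u r : Fin s → F[X],
    (∀ j, IsLeftDivision θ δ (solP v j) (solSigma v) (u j) (r j)) ∧
    (((∃ j, r j ≠ 0 ∨ (k : WithBot ℕ) ≤ (u j).degree) ∧ out = none) ∨
     ((∀ j, r j = 0 ∧ (u j).degree < (k : WithBot ℕ)) ∧ out = some u))

end Skew

section Error

variable (K : Type*) {F : Type*} [Field K] [Field F] [Algebra K F]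
variable {ℓ s : ℕ} {n : Fin ℓ → ℕ}

/-- The rank over `K` of the block `e^(i) = (e₁^(i) | ⋯ | e_s^(i))`, that is, the maximal number
of `K`-linearly independent entries. -/
noncomputable def blockRank (e : (Σ i, Fin (n i)) × Fin s → F) (i : Fin ℓ) : ℕ :=
  Module.finrank K
    (Submodule.span K (Set.range fun x : Fin (n i) × Fin s => e (⟨i, x.1⟩, x.2)))

/-- The sum-rank weight of an interleaved vector (for the block-ordered length partition). -/
noncomputable def sumRankWeight (e : (Σ i, Fin (n i)) × Fin s → F) : ℕ :=
  ∑ i, blockRank K e i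

variable {K}

/-- The matrix `B` assembled from its blocks: `B = (B₁ | ⋯ | B_s)` with
`B_j = diag(B_j^(1), …, B_j^(ℓ))`. -/
def errMatrix {τ : Fin ℓ → ℕ} (B : Fin s → ∀ i, Matrix (Fin (τ i)) (Fin (n i)) K) :
    Matrix (Σ i, Fin (τ i)) ((Σ i, Fin (n i)) × Fin s) K :=
  Matrix.of fun r x => Matrix.blockDiagonal' (B x.2) r x.1

/-- `e = a · B` is an error decomposition of `e`: `τ` is the rank partition of `e`, the entries of
each `a^(i)` are `K`-linearly independent, each `(B₁^(i) | ⋯ | B_s^(i))` has rank `τ i`. -/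
structure IsErrorDecomposition (e : (Σ i, Fin (n i)) × Fin s → F) (τ : Fin ℓ → ℕ)
    (a : (Σ i, Fin (τ i)) → F) (B : Fin s → ∀ i, Matrix (Fin (τ i)) (Fin (n i)) K) : Prop where
  rank_eq : ∀ i, τ i = blockRank K e i
  indep_a : ∀ i, LinearIndependent K fun r : Fin (τ i) => a ⟨i, r⟩
  rank_B : ∀ i, (Matrix.of fun (r : Fin (τ i)) (x : Fin (n i) × Fin s) => B x.2 i r x.1).rank = τ i
  eq_mul : e = Matrix.vecMul a ((errMatrix B).map (algebraMap K F))

end Error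

end HILRS

namespace HILRS

/-! ### The skew-polynomial ring: degrees, left division and operator evaluation. -/

section SkewAlgebra

variable {F : Type*} [Field F] (θ : F ≃+* F) (δ : F →+ F)

/-! Everything reduces to the size of the solution space of the decoder's system. Evaluation at a
fixed parameter turns skew products into composition and is `K`-linear in the point, so the system
says `p_j(β_j) = σ(y_j) = (σ f_j)(β_j) + σ(e_j)`. Hence `σ` extends to a solution exactly when `σ(e)
= σ(a) B` lies in the interleaved code with parameter `k + t`, that is, when `σ(a) B Hᵀ = 0`. The
extension is unique because `t + k ≤ n`.

The arithmetic input is `sum_finrank_le_natDegree`: a nonzero skew polynomial of degree `d` has zero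
spaces of total dimension at most `d` over non-conjugate parameters. It gives both this uniqueness
and the surjectivity of `σ ↦ σ(a)` from `F^(t+1)` to `F^t`. The solution space therefore has
dimension `t + 1 - rk(B Hᵀ)`. Rank-nullity for `Mᵀ`, which has `s(t + k) + t + 1` columns, then
yields the first two claims.

If `rk(B Hᵀ) = t`, every solution satisfies `σ(a) = 0`, so `σ(e) = 0` and `p_j = σ f_j`. Left
division is unique, so it recovers `f_j`. -/

theorem xMul_monomial (j : ℕ) (b : F) :
    xMul θ δ (monomial j b) = monomial (j + 1) (θ b) + monomial j (δ b) := by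
  unfold xMul
  rw [sum_monomial_index]
  simp

theorem xMul_add (f g : F[X]) : xMul θ δ (f + g) = xMul θ δ f + xMul θ δ g := by
  unfold xMul
  rw [sum_add_index]
  · simp
  · intro i a b
    simp only [map_add]
    abel

theorem xMul_zero : xMul θ δ 0 = 0 := by simp [xMul]

theorem iterate_xMul_add (i : ℕ) (f g : F[X]) :
    (xMul θ δ)^[i] (f + g) = (xMul θ δ)^[i] f + (xMul θ δ)^[i] g := by
  induction i with
  | zero => rfl
  | succ i ih => simp only [Function.iterate_succ_apply', ih, xMul_add]

theorem coeff_xMul_succ (g : F[X]) (j : ℕ) :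
    (xMul θ δ g).coeff (j + 1) = θ (g.coeff j) + δ (g.coeff (j + 1)) := by
  induction g using Polynomial.induction_on' with
  | add p q hp hq => simp only [xMul_add, coeff_add, hp, hq, map_add]; abel
  | monomial m b =>
    simp only [xMul_monomial, coeff_add, coeff_monomial, add_left_inj]
    split_ifs <;> simp

theorem natDegree_xMul_le {g : F[X]} {d : ℕ} (h : g.natDegree ≤ d) :
    (xMul θ δ g).natDegree ≤ d + 1 := by
  rw [natDegree_le_iff_coeff_eq_zero]
  intro N hN
  obtain ⟨N, rfl⟩ : ∃ N', N = N' + 1 := ⟨N - 1, by omega⟩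
  rw [coeff_xMul_succ, coeff_eq_zero_of_natDegree_lt (by omega),
    coeff_eq_zero_of_natDegree_lt (by omega)]
  simp

theorem natDegree_iterate_xMul_le {g : F[X]} {d : ℕ} (h : g.natDegree ≤ d) (i : ℕ) :
    ((xMul θ δ)^[i] g).natDegree ≤ d + i := by
  induction i with
  | zero => simpa
  | succ i ih =>
    rw [Function.iterate_succ_apply']
    exact natDegree_xMul_le θ δ ih

theorem coeff_iterate_xMul {g : F[X]} {d : ℕ} (h : g.natDegree ≤ d) (i : ℕ) :
    ((xMul θ δ)^[i] g).coeff (d + i) = θ^[i] (g.coeff d) := by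
  induction i with
  | zero => simp
  | succ i ih =>
    have := natDegree_iterate_xMul_le θ δ h i
    rw [Function.iterate_succ_apply', Function.iterate_succ_apply', ← ih, ← add_assoc,
      coeff_xMul_succ, coeff_eq_zero_of_natDegree_lt (n := d + i + 1) (by omega)]
    simp

theorem skewMul_add_left (f f' g : F[X]) :
    skewMul θ δ (f + f') g = skewMul θ δ f g + skewMul θ δ f' g := by
  unfold skewMul
  rw [sum_add_index]
  · simp
  · intro i a b
    rw [C_add, add_mul]

theorem skewMul_add_right (f g g' : F[X]) :
    skewMul θ δ f (g + g') = skewMul θ δ f g + skewMul θ δ f g' := by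
  unfold skewMul
  simp only [iterate_xMul_add, mul_add]
  rw [sum_add]

theorem skewMul_monomial (i : ℕ) (a : F) (g : F[X]) :
    skewMul θ δ (monomial i a) g = C a * (xMul θ δ)^[i] g := by
  unfold skewMul
  rw [sum_monomial_index]
  simp

theorem natDegree_skewMul_le {f g : F[X]} {m d : ℕ} (hf : f.natDegree ≤ m)
    (hg : g.natDegree ≤ d) : (skewMul θ δ f g).natDegree ≤ d + m := by
  refine natDegree_sum_le_of_forall_le _ _ fun i hi => ?_
  refine (natDegree_C_mul_le _ _).trans ((natDegree_iterate_xMul_le θ δ hg i).trans ?_)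
  have := le_natDegree_of_mem_supp i hi
  omega

/-- Only `f_m x^m · g` reaches degree `d + m`, and `δ` never raises degree, so the top coefficient
sees `θ` alone. -/
theorem coeff_skewMul {f g : F[X]} {m d : ℕ} (hf : f.natDegree ≤ m) (hg : g.natDegree ≤ d) :
    (skewMul θ δ f g).coeff (d + m) = f.coeff m * θ^[m] (g.coeff d) := by
  unfold skewMul
  rw [sum_def, finsetSum_coeff, Finset.sum_eq_single m]
  · rw [coeff_C_mul, coeff_iterate_xMul θ δ hg]
  · intro i hi him
    have := le_natDegree_of_mem_supp i hi
    have := natDegree_iterate_xMul_le θ δ hg i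
    rw [coeff_C_mul, coeff_eq_zero_of_natDegree_lt (n := d + m) (by omega), mul_zero]
  · intro h
    rw [notMem_support_iff.mp h]
    simp

theorem iterate_ringEquiv_ne_zero {x : F} (hx : x ≠ 0) (i : ℕ) : θ^[i] x ≠ 0 := by
  induction i with
  | zero => simpa
  | succ i ih => rw [Function.iterate_succ_apply']; simpa

/-- Leading coefficients multiply up to a power of the injective map `θ`, so they cannot cancel. -/
theorem degree_skewMul (f g : F[X]) : (skewMul θ δ f g).degree = f.degree + g.degree := by
  by_cases hf : f = 0
  · simp [hf, skewMul]
  by_cases hg : g = 0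
  · have h0 : ∀ i, (xMul θ δ)^[i] 0 = 0 := fun i => by
      induction i with
      | zero => rfl
      | succ i ih => rw [Function.iterate_succ_apply', ih, xMul_zero]
    simp [hg, skewMul, h0, sum_def]
  have hc := coeff_skewMul θ δ (le_refl f.natDegree) (le_refl g.natDegree)
  have hne : (skewMul θ δ f g).coeff (g.natDegree + f.natDegree) ≠ 0 := by
    rw [hc]
    exact mul_ne_zero (leadingCoeff_ne_zero.mpr hf)
      (iterate_ringEquiv_ne_zero θ (leadingCoeff_ne_zero.mpr hg) _)
  have hn := natDegree_eq_of_le_of_coeff_ne_zero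
    (natDegree_skewMul_le θ δ (le_refl f.natDegree) (le_refl g.natDegree)) hne
  have h0 : skewMul θ δ f g ≠ 0 := fun h => hne (by simp [h])
  rw [degree_eq_natDegree h0, degree_eq_natDegree hf, degree_eq_natDegree hg, hn, add_comm]
  push_cast
  rfl

/-- Used to split off a linear right factor at a zero; `x - c` is monic, so long division works. -/
theorem exists_skewMul_X_sub_C_add_C (c : F) (d : ℕ) :
    ∀ f : F[X], f.natDegree ≤ d →
      ∃ (g : F[X]) (r : F), f = skewMul θ δ g (X - C c) + C r := by
  induction d with
  | zero =>
    intro f hf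
    exact ⟨0, f.coeff 0, by simpa [skewMul] using eq_C_of_natDegree_le_zero hf⟩
  | succ d ih =>
    intro f hf
    have hX : (X - C c : F[X]).natDegree ≤ 1 := natDegree_X_sub_C_le c
    have hm : (monomial d (f.coeff (d + 1))).natDegree ≤ d := natDegree_monomial_le _
    -- Since `θ` fixes `1`, subtracting `f_(d+1) x^d · (x - c)` cancels the coefficient of degree `d
    -- + 1`.
    obtain ⟨g, r, h⟩ := ih (f - skewMul θ δ (monomial d (f.coeff (d + 1))) (X - C c)) (by
      rw [natDegree_le_iff_coeff_eq_zero]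
      intro N hN
      have h1 := natDegree_skewMul_le θ δ hm hX
      have h2 := coeff_skewMul θ δ hm hX
      rcases Nat.lt_or_ge (d + 1) N with hlt | hge
      · rw [coeff_sub, coeff_eq_zero_of_natDegree_lt (by omega),
          coeff_eq_zero_of_natDegree_lt (by omega), sub_zero]
      · obtain rfl : N = 1 + d := by omega
        have h1 : θ^[d] 1 = 1 := Function.iterate_fixed (map_one θ) d
        rw [coeff_sub, h2]
        simp [h1, add_comm])
    exact ⟨g + monomial d (f.coeff (d + 1)), r, by
      rw [skewMul_add_left, add_right_comm, ← h, sub_add_cancel]⟩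

theorem opEval_add_left (f g : F[X]) (b a : F) :
    opEval θ δ (f + g) b a = opEval θ δ f b a + opEval θ δ g b a := by
  unfold opEval
  rw [sum_add_index]
  · simp
  · intro i x y
    rw [add_mul]

theorem opEval_monomial (i : ℕ) (x b a : F) :
    opEval θ δ (monomial i x) b a = x * (op θ δ a)^[i] b := by
  unfold opEval
  rw [sum_monomial_index]
  simp

theorem opEval_C (x b a : F) : opEval θ δ (C x) b a = x * b :=
  opEval_monomial θ δ 0 x b a

theorem opEval_zero_left (b a : F) : opEval θ δ 0 b a = 0 := by simp [opEval]

theorem opEval_sum {ι : Type*} (S : Finset ι) (f : ι → F[X]) (b a : F) :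
    opEval θ δ (∑ i ∈ S, f i) b a = ∑ i ∈ S, opEval θ δ (f i) b a :=
  map_sum (⟨⟨fun f => opEval θ δ f b a, opEval_zero_left θ δ b a⟩,
    fun f g => opEval_add_left θ δ f g b a⟩ : F[X] →+ F) f S

theorem opEval_sub (f g : F[X]) (b a : F) :
    opEval θ δ (f - g) b a = opEval θ δ f b a - opEval θ δ g b a :=
  map_sub (⟨⟨fun f => opEval θ δ f b a, opEval_zero_left θ δ b a⟩,
    fun f g => opEval_add_left θ δ f g b a⟩ : F[X] →+ F) f g

theorem opEval_C_mul (x : F) (f : F[X]) (b a : F) :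
    opEval θ δ (C x * f) b a = x * opEval θ δ f b a := by
  induction f using Polynomial.induction_on' with
  | add p q hp hq => simp only [mul_add, opEval_add_left, hp, hq]
  | monomial m y => rw [C_mul_monomial, opEval_monomial, opEval_monomial, mul_assoc]

theorem op_add (a b b' : F) : op θ δ a (b + b') = op θ δ a b + op θ δ a b' := by
  simp only [op, map_add]
  ring

variable {δ}

/-- The derivation rule makes `D_a` satisfy the commutation rule of `x` with scalars, so `x` acts as
`D_a`. -/
theorem opEval_xMul (hδ : IsDerivation θ δ) (g : F[X]) (b a : F) :
    opEval θ δ (xMul θ δ g) b a = op θ δ a (opEval θ δ g b a) := by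
  induction g using Polynomial.induction_on' with
  | add p q hp hq => rw [xMul_add, opEval_add_left, opEval_add_left, op_add, hp, hq]
  | monomial m y =>
    rw [xMul_monomial, opEval_add_left, opEval_monomial, opEval_monomial, opEval_monomial,
      Function.iterate_succ_apply']
    simp only [op, map_mul, hδ y]
    ring

theorem opEval_skewMul (hδ : IsDerivation θ δ) (f g : F[X]) (b a : F) :
    opEval θ δ (skewMul θ δ f g) b a = opEval θ δ f (opEval θ δ g b a) a := by
  have hit : ∀ i, opEval θ δ ((xMul θ δ)^[i] g) b a = (op θ δ a)^[i] (opEval θ δ g b a) := by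
    intro i
    induction i with
    | zero => rfl
    | succ i ih => rw [Function.iterate_succ_apply', Function.iterate_succ_apply',
        opEval_xMul θ hδ, ih]
  induction f using Polynomial.induction_on' with
  | add p q hp hq => rw [skewMul_add_left, opEval_add_left, opEval_add_left, hp, hq]
  | monomial m y => rw [skewMul_monomial, opEval_C_mul, opEval_monomial, hit]

theorem opEval_X_sub_C (c b a : F) : opEval θ δ (X - C c) b a = op θ δ a b - c * b := by
  rw [opEval_sub, opEval_C, ← monomial_one_one_eq_X, opEval_monomial]
  simp

/-- If the quotients differed, `d · (u' - u) = r - r'` would have degree at least `deg d`, against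
the bound on the remainders. -/
theorem IsLeftDivision.unique {p d u u' r r' : F[X]} (h : IsLeftDivision θ δ p d u r)
    (h' : IsLeftDivision θ δ p d u' r') : u = u' ∧ r = r' := by
  have h1 : skewMul θ δ d (u' - u) = r - r' := by
    have h2 := skewMul_add_right θ δ d (u' - u) u
    rw [sub_add_cancel] at h2
    have h3 := h.1.symm.trans h'.1
    rw [h2] at h3
    linear_combination -h3
  have h4 : u = u' := by
    by_contra hne
    have h5 : (r - r').degree < d.degree :=
      (degree_sub_le _ _).trans_lt (max_lt h.2 h'.2)
    rw [← h1, degree_skewMul] at h5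
    have h6 : 0 ≤ (u' - u).degree := zero_le_degree_iff.mpr (sub_ne_zero.mpr (Ne.symm hne))
    exact absurd (le_add_of_nonneg_right h6) (not_le.mpr h5)
  refine ⟨h4, ?_⟩
  have h3 := h.1.symm.trans h'.1
  rw [h4] at h3
  exact add_left_cancel h3

end SkewAlgebra

/-! ### Linearity of evaluation and the bound on the number of zeros. -/

section Linear

variable {K F : Type*} [Field K] [Field F] [Algebra K F]
variable (θ : F ≃+* F) (δ : F →+ F)

/-- `f ↦ f(b)_a` is linear in `b` over any subfield fixed by `θ` and annihilated by `δ`. -/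
noncomputable def evalLin (hδ : IsDerivation θ δ)
    (hθK : ∀ x : K, θ (algebraMap K F x) = algebraMap K F x)
    (hδK : ∀ x : K, δ (algebraMap K F x) = 0) (f : F[X]) (a : F) : F →ₗ[K] F where
  toFun b := opEval θ δ f b a
  map_add' b b' := by
    have hit : ∀ i, (op θ δ a)^[i] (b + b') = (op θ δ a)^[i] b + (op θ δ a)^[i] b' := by
      intro i
      induction i with
      | zero => rfl
      | succ i ih => simp only [Function.iterate_succ_apply', ih, op_add]
    simp only [opEval, hit, mul_add, sum_add]
  map_smul' x b := by
    have hit : ∀ i, (op θ δ a)^[i] (x • b) = x • (op θ δ a)^[i] b := by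
      intro i
      induction i with
      | zero => rfl
      | succ i ih =>
        simp only [Function.iterate_succ_apply', ih]
        simp only [op, Algebra.smul_def, map_mul, hθK, hδ (algebraMap K F x), hδK]
        ring
    simp only [opEval, hit, mul_smul_comm, sum_def, RingHom.id_apply, Finset.smul_sum]

variable {θ δ}

/-- If two nonzero points have the same value of `D(b) b⁻¹` then their quotient conjugates the
evaluation parameters. -/
theorem conj_of_op_eq (hδ : IsDerivation θ δ) {x x' b z c : F} (hb : b ≠ 0)
    (h : op θ δ x b = c * b) (hz : op θ δ x' z = c * z) :
    θ (z / b) * x' + δ (z / b) = x * (z / b) := by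
  have hzb : b * (z / b) = z := mul_div_cancel₀ z hb
  generalize z / b = u at hzb ⊢
  subst hzb
  have h1 : θ b ≠ 0 := by simpa using hb
  apply mul_left_cancel₀ h1
  simp only [op, map_mul, hδ b] at h hz
  linear_combination hz - u * h

/-- The number of zeros of a nonzero skew polynomial, counted by the dimensions of zero spaces at
pairwise non-conjugate evaluation parameters, is at most its degree. -/
theorem sum_finrank_le_natDegree [FiniteDimensional K F] (hδ : IsDerivation θ δ)
    (hθK : ∀ x : K, θ (algebraMap K F x) = algebraMap K F x)
    (hδK : ∀ x : K, δ (algebraMap K F x) = 0)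
    {ι : Type*} [Fintype ι] {ξ : ι → F}
    (hξ : ∀ i i', i ≠ i' → ¬ Conj θ δ (ξ i) (ξ i'))
    (hξ' : ∀ i, centralizer θ δ (ξ i) = Set.range (algebraMap K F)) (d : ℕ) :
    ∀ (f : F[X]), f ≠ 0 → f.natDegree ≤ d → ∀ V : ι → Submodule K F,
      (∀ i, ∀ b ∈ V i, opEval θ δ f b (ξ i) = 0) → ∑ i, Module.finrank K (V i) ≤ d := by
  classical
  induction d with
  | zero =>
    intro f hf hd V hV
    have hfC := eq_C_of_natDegree_le_zero hd
    have hV0 : ∀ i, V i = ⊥ := fun i => by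
      rw [Submodule.eq_bot_iff]
      intro b hb
      have := hV i b hb
      rw [hfC, opEval_C] at this
      refine (mul_eq_zero.mp this).resolve_left fun h => hf ?_
      rw [hfC, h, C_0]
    simp [hV0]
  | succ d ih =>
    intro f hf hd V hV
    by_cases hall : ∀ i, V i = ⊥
    · exact (Finset.sum_eq_zero fun i _ => by rw [hall i]; exact finrank_bot K F).trans_le
        (Nat.zero_le _)
    push Not at hall
    obtain ⟨i₀, hi₀⟩ := hall
    obtain ⟨b, hbV, hb⟩ := Submodule.exists_mem_ne_zero_of_ne_bot hi₀
    -- This choice makes `x - c` vanish at `b` with parameter `ξ i₀`, so it divides `f` on the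
    -- right.
    set c := op θ δ (ξ i₀) b / b with hc
    have hcb : op θ δ (ξ i₀) b = c * b := (div_mul_cancel₀ _ hb).symm
    obtain ⟨g, r, hg⟩ := exists_skewMul_X_sub_C_add_C θ δ c _ f hd
    have hr : r = 0 := by
      have h1 := hV i₀ b hbV
      rw [hg, opEval_add_left, opEval_skewMul θ hδ, opEval_X_sub_C, hcb, sub_self, opEval_C,
        show opEval θ δ g 0 (ξ i₀) = 0 from map_zero (evalLin θ δ hδ hθK hδK g (ξ i₀)),
        zero_add] at h1
      exact (mul_eq_zero.mp h1).resolve_right hb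
    rw [hr, C_0, add_zero] at hg
    have hg0 : g ≠ 0 := by
      rintro rfl
      exact hf (by simpa [skewMul] using hg)
    have hgd : g.natDegree ≤ d := by
      have h1 := degree_skewMul θ δ g (X - C c)
      rw [← hg, degree_X_sub_C, degree_eq_natDegree hf, degree_eq_natDegree hg0] at h1
      have h2 : f.natDegree = g.natDegree + 1 := by exact_mod_cast h1
      omega
    let L : ι → F →ₗ[K] F := fun i => evalLin θ δ hδ hθK hδK (X - C c) (ξ i)
    have hL : ∀ i z, L i z = op θ δ (ξ i) z - c * z := fun i z => opEval_X_sub_C θ c z (ξ i)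
    -- As `f = g · (x - c)`, the values of `x - c` on `V i` are zeros of `g`; the loss of dimension
    -- is the kernel of `x - c`.
    have h1 := ih g hg0 hgd (fun i => (V i).map (L i)) (by
      rintro i _ ⟨z, hz, rfl⟩
      have := hV i z hz
      rwa [hg, opEval_skewMul θ hδ] at this)
    -- For `z` in the kernel, `z / b` centralizes `ξ i₀` when `i = i₀`, giving the line `K b`.
    -- Otherwise a nonzero `z / b` would conjugate `ξ i` into `ξ i₀`.
    have hker : ∀ i, Module.finrank K (LinearMap.ker ((L i).domRestrict (V i))) ≤
        if i = i₀ then 1 else 0 := by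
      intro i
      have hz : ∀ z : LinearMap.ker ((L i).domRestrict (V i)),
          θ ((z : V i) / b) * ξ i + δ ((z : V i) / b) = ξ i₀ * ((z : V i) / b) := fun z =>
        conj_of_op_eq hδ hb hcb (sub_eq_zero.mp ((hL i _).symm.trans z.2))
      split_ifs with hi
      · subst hi
        refine finrank_le_one ⟨⟨b, hbV⟩, ?_⟩ fun z => ?_
        · rw [LinearMap.mem_ker, LinearMap.domRestrict_apply, hL, hcb, sub_self]
        · obtain ⟨w, hw⟩ : ((z : V i) : F) / b ∈ Set.range (algebraMap K F) := by
            rw [← hξ' i]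
            exact hz z
          refine ⟨w, ?_⟩
          ext
          simp [Algebra.smul_def, hw, hb]
      · rw [Nat.le_zero, Submodule.finrank_eq_zero, Submodule.eq_bot_iff]
        intro z hzk
        by_contra hne
        have hz0 : ((z : F) / b) ≠ 0 := div_ne_zero (by simpa using hne) hb
        refine hξ i i₀ hi ⟨(z : F) / b, hz0, ?_⟩
        rw [← add_mul, hz ⟨z, hzk⟩, mul_inv_cancel_right₀ hz0]
    have hsum : ∀ i, Module.finrank K (V i) ≤
        Module.finrank K ((V i).map (L i)) + if i = i₀ then 1 else 0 := by
      intro i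
      have h2 := LinearMap.finrank_range_add_finrank_ker ((L i).domRestrict (V i))
      rw [LinearMap.range_domRestrict] at h2
      have := hker i
      omega
    refine (Finset.sum_le_sum fun i _ => hsum i).trans ?_
    rw [Finset.sum_add_distrib, Finset.sum_ite_eq' Finset.univ i₀]
    simpa using h1

/-- A skew polynomial of degree less than the number of its block-wise independent zeros is `0`. -/
theorem eq_zero_of_opEval_eq_zero [FiniteDimensional K F] (hδ : IsDerivation θ δ)
    (hθK : ∀ x : K, θ (algebraMap K F x) = algebraMap K F x)
    (hδK : ∀ x : K, δ (algebraMap K F x) = 0)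
    {ℓ : ℕ} {ξ : Fin ℓ → F}
    (hξ : ∀ i i', i ≠ i' → ¬ Conj θ δ (ξ i) (ξ i'))
    (hξ' : ∀ i, centralizer θ δ (ξ i) = Set.range (algebraMap K F))
    {n : Fin ℓ → ℕ} {z : (Σ i, Fin (n i)) → F}
    (hz : ∀ i, LinearIndependent K fun p : Fin (n i) => z ⟨i, p⟩)
    {f : F[X]} (hf : f.degree < ((∑ i, n i : ℕ) : WithBot ℕ))
    (h : ∀ p, opEval θ δ f (z p) (ξ p.1) = 0) : f = 0 := by
  by_contra hf0
  have h1 := sum_finrank_le_natDegree hδ hθK hδK hξ hξ' _ f hf0 le_rfl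
    (fun i => Submodule.span K (Set.range fun p : Fin (n i) => z ⟨i, p⟩)) (by
      intro i b hb
      have hle : Submodule.span K (Set.range fun p : Fin (n i) => z ⟨i, p⟩) ≤
          LinearMap.ker (evalLin θ δ hδ hθK hδK f (ξ i)) := by
        rw [Submodule.span_le]
        rintro _ ⟨p, rfl⟩
        exact h ⟨i, p⟩
      exact hle hb)
  simp only [finrank_span_eq_card (hz _), Fintype.card_fin] at h1
  rw [degree_eq_natDegree hf0] at hf
  have : f.natDegree < ∑ i, n i := by exact_mod_cast hf
  omega

end Linear

/-! ### Coefficient vectors and the linear system as a key equation. -/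

section Coefficients

variable {F : Type*} [Field F]

/-- The polynomial with a given coefficient vector. -/
noncomputable def polyOf {d : ℕ} (v : Fin d → F) : F[X] := ∑ i : Fin d, monomial (i : ℕ) (v i)

theorem coeff_polyOf {d : ℕ} (v : Fin d → F) (i : Fin d) : (polyOf v).coeff i = v i := by
  simp [polyOf, coeff_monomial, Fin.val_inj]

theorem degree_polyOf_lt {d : ℕ} (v : Fin d → F) : (polyOf v).degree < (d : WithBot ℕ) := by
  rw [degree_lt_iff_coeff_zero]
  intro m hm
  rw [polyOf, finsetSum_coeff]
  refine Finset.sum_eq_zero fun i _ => ?_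
  rw [coeff_monomial, if_neg (by have := i.2; omega)]

theorem polyOf_coeff {d : ℕ} {f : F[X]} (hf : f.degree < (d : WithBot ℕ)) :
    polyOf (fun i : Fin d => f.coeff i) = f := by
  ext m
  by_cases hm : m < d
  · exact coeff_polyOf (fun i : Fin d => f.coeff i) ⟨m, hm⟩
  · rw [(degree_lt_iff_coeff_zero _ _).mp (degree_polyOf_lt _) m (by omega),
      (degree_lt_iff_coeff_zero _ _).mp hf m (by omega)]

theorem polyOf_eq_zero {d : ℕ} {v : Fin d → F} : polyOf v = 0 ↔ v = 0 := by
  refine ⟨fun h => ?_, ?_⟩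
  · ext i
    rw [← coeff_polyOf v i, h]
    simp
  · rintro rfl
    simp [polyOf]

theorem polyOf_add {d : ℕ} (v w : Fin d → F) : polyOf (v + w) = polyOf v + polyOf w := by
  simp [polyOf, Finset.sum_add_distrib]

theorem polyOf_smul {d : ℕ} (c : F) (v : Fin d → F) : polyOf (c • v) = C c * polyOf v := by
  simp [polyOf, Finset.mul_sum, C_mul_monomial]

variable (θ : F ≃+* F) (δ : F →+ F)

theorem opEval_polyOf {d : ℕ} (v : Fin d → F) (b a : F) :
    opEval θ δ (polyOf v) b a = ∑ i, v i * (op θ δ a)^[(i : ℕ)] b := by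
  simp [polyOf, opEval_sum, opEval_monomial]

/-- Evaluation at the points `z` of the skew polynomial with a given coefficient vector. -/
noncomputable def multiEval {ι κ : Type*} (d : ℕ) (ξ : ι → F) (i : κ → ι) (z : κ → F) :
    (Fin d → F) →ₗ[F] (κ → F) where
  toFun v x := opEval θ δ (polyOf v) (z x) (ξ (i x))
  map_add' v w := by
    ext x
    simp [polyOf_add, opEval_add_left]
  map_smul' c v := by
    ext x
    simp [polyOf_smul, opEval_C_mul]

/-- A row of `Mᵀ` lists the powers of `D_ξ` at one locator and, negated, at the received symbol, so
its product with `v` is a difference of two evaluations. -/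
theorem mem_solutionSpace {ℓ s k t : ℕ} {n : Fin ℓ → ℕ} {ξ : Fin ℓ → F}
    {β : Fin s → (Σ i, Fin (n i)) → F} {y : (Σ i, Fin (n i)) × Fin s → F}
    {v : (Fin (t + k) × Fin s) ⊕ Fin (t + 1) → F} :
    v ∈ solutionSpace θ δ ξ β k t y ↔ ∀ p j, opEval θ δ (solP v j) (β j p) (ξ p.1) =
      opEval θ δ (solSigma v) (y (p, j)) (ξ p.1) := by
  have h : ∀ p j, (gaoMatrixT θ δ ξ β k t y).mulVec v (p, j) =
      opEval θ δ (solP v j) (β j p) (ξ p.1) - opEval θ δ (solSigma v) (y (p, j)) (ξ p.1) := by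
    intro p j
    rw [show solP v j = polyOf fun i => v (Sum.inl (i, j)) from rfl,
      show solSigma v = polyOf fun i => v (Sum.inr i) from rfl, opEval_polyOf, opEval_polyOf]
    simp only [gaoMatrixT, Matrix.mulVec, dotProduct, Fintype.sum_sum_type,
      Matrix.fromCols_apply_inl, Matrix.fromCols_apply_inr, Matrix.of_apply, moore, component,
      Matrix.transpose_apply, neg_mul, Finset.sum_neg_distrib, sub_eq_add_neg,
      Matrix.blockDiagonal_apply, Fintype.sum_prod_type, ite_mul, zero_mul, Finset.sum_ite_eq,
      Finset.mem_univ, if_true]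
    simp only [mul_comm]
  rw [solutionSpace, LinearMap.mem_ker, Matrix.mulVecLin_apply, funext_iff]
  simp only [Prod.forall, h, Pi.zero_apply, sub_eq_zero]

variable {θ δ}

theorem degree_skewMul_lt {f g : F[X]} {t k : ℕ} (hf : f.degree < ((t + 1 : ℕ) : WithBot ℕ))
    (hg : g.degree < (k : WithBot ℕ)) :
    (skewMul θ δ f g).degree < ((t + k : ℕ) : WithBot ℕ) := by
  rw [degree_skewMul]
  by_cases hf0 : f = 0
  · simp [hf0]
  by_cases hg0 : g = 0
  · simp [hg0]
  rw [degree_eq_natDegree hf0] at hf ⊢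
  rw [degree_eq_natDegree hg0] at hg ⊢
  norm_cast at hf hg ⊢
  omega

end Coefficients

/-! ### Reduction of the decoder to the map sending `σ` to `σ(a) B Hᵀ`. -/

section Decoding

variable {K F : Type*} [Field K] [Field F] [Algebra K F]
variable {θ : F ≃+* F} {δ : F →+ F}

/-- A derivation of a finite field annihilates the fixed field of the automorphism. -/
theorem IsDerivation.apply_algebraMap_eq_zero [Finite F] (hδ : IsDerivation θ δ)
    (hθK : ∀ x : K, θ (algebraMap K F x) = algebraMap K F x) (x : K) :
    δ (algebraMap K F x) = 0 := by
  have : Finite K := Finite.of_injective _ (algebraMap K F).injective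
  cases nonempty_fintype K
  set c := algebraMap K F x
  -- The usual power rule holds because `θ` fixes `c`. Applied to `c^q = c`, it gives `δ c = q
  -- c^(q-1) δ c = 0`.
  have hpow : ∀ m : ℕ, δ (c ^ (m + 1)) = (m + 1 : ℕ) * c ^ m * δ c := by
    intro m
    induction m with
    | zero => simp
    | succ m ih =>
      rw [pow_succ', hδ, ih, hθK x]
      push_cast
      ring
  have h1 := hpow (Fintype.card K - 1)
  rw [Nat.sub_add_cancel Fintype.card_pos] at h1
  have h2 : c ^ Fintype.card K = c := by
    rw [← map_pow, FiniteField.pow_card]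
  have h3 : ((Fintype.card K : ℕ) : F) = 0 := by
    rw [← map_natCast (algebraMap K F), FiniteField.cast_card_eq_zero, map_zero]
  rwa [h2, h3, zero_mul, zero_mul] at h1

theorem opEval_add_right (hδ : IsDerivation θ δ)
    (hθK : ∀ x : K, θ (algebraMap K F x) = algebraMap K F x)
    (hδK : ∀ x : K, δ (algebraMap K F x) = 0) (f : F[X]) (b b' a : F) :
    opEval θ δ f (b + b') a = opEval θ δ f b a + opEval θ δ f b' a :=
  map_add (evalLin θ δ hδ hθK hδK f a) b b'

/-- Evaluation commutes with multiplication by the row-space matrix of the error. -/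
theorem opEval_vecMul_errMatrix (hδ : IsDerivation θ δ)
    (hθK : ∀ x : K, θ (algebraMap K F x) = algebraMap K F x)
    (hδK : ∀ x : K, δ (algebraMap K F x) = 0)
    {ℓ s : ℕ} {n τ : Fin ℓ → ℕ} {ξ : Fin ℓ → F} (a : (Σ i, Fin (τ i)) → F)
    (B : Fin s → ∀ i, Matrix (Fin (τ i)) (Fin (n i)) K) (f : F[X])
    (x : (Σ i, Fin (n i)) × Fin s) :
    opEval θ δ f (Matrix.vecMul a ((errMatrix B).map (algebraMap K F)) x) (ξ x.1.1) =
      Matrix.vecMul (fun r => opEval θ δ f (a r) (ξ r.1))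
        ((errMatrix B).map (algebraMap K F)) x := by
  change evalLin θ δ hδ hθK hδK f (ξ x.1.1) _ = _
  simp only [Matrix.vecMul, dotProduct, map_sum, Matrix.map_apply]
  refine Finset.sum_congr rfl fun r _ => ?_
  rw [mul_comm, ← Algebra.smul_def, map_smul, Algebra.smul_def, mul_comm]
  -- The two evaluation parameters differ only across blocks, and there the block-diagonal entry is
  -- zero.
  by_cases h : r.1 = x.1.1
  · rw [← h]
    rfl
  · have h0 : errMatrix B r x = 0 := by
      rw [errMatrix, Matrix.of_apply, Matrix.blockDiagonal'_apply, dif_neg h]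
    simp [h0]

/-- Coefficient vectors of length `t + 1` evaluate surjectively at `t` block-wise independent
points. -/
theorem multiEval_surjective [FiniteDimensional K F] (hδ : IsDerivation θ δ)
    (hθK : ∀ x : K, θ (algebraMap K F x) = algebraMap K F x)
    (hδK : ∀ x : K, δ (algebraMap K F x) = 0)
    {ℓ : ℕ} {ξ : Fin ℓ → F} (hξ : ∀ i i', i ≠ i' → ¬ Conj θ δ (ξ i) (ξ i'))
    (hξ' : ∀ i, centralizer θ δ (ξ i) = Set.range (algebraMap K F))
    {τ : Fin ℓ → ℕ} {a : (Σ i, Fin (τ i)) → F}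
    (ha : ∀ i, LinearIndependent K fun p : Fin (τ i) => a ⟨i, p⟩) {t : ℕ} (ht : ∑ i, τ i = t) :
    Function.Surjective (multiEval θ δ (t + 1) ξ Sigma.fst a) := by
  set E := multiEval θ δ (t + 1) ξ Sigma.fst a
  -- The coefficient at `x^t` is injective on the kernel: if it is zero, the degree is below `t`
  -- while there are `t` independent zeros.
  have hker : Module.finrank F (LinearMap.ker E) ≤ 1 := by
    have hinj : Function.Injective
        ((LinearMap.proj (Fin.last t) : (Fin (t + 1) → F) →ₗ[F] F).domRestrict
          (LinearMap.ker E)) := by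
      rw [injective_iff_map_eq_zero]
      rintro ⟨v, hv⟩ h0
      rw [LinearMap.domRestrict_apply, LinearMap.proj_apply] at h0
      ext1
      refine polyOf_eq_zero.mp (eq_zero_of_opEval_eq_zero hδ hθK hδK hξ hξ' ha ?_
        (fun p => congrFun hv p))
      rw [ht, degree_lt_iff_coeff_zero]
      intro m hm
      rcases hm.eq_or_lt with rfl | hlt
      · exact (coeff_polyOf v (Fin.last t)).trans h0
      · exact (degree_lt_iff_coeff_zero _ _).mp (degree_polyOf_lt v) m hlt
    simpa using LinearMap.finrank_le_finrank_of_injective hinj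
  rw [← LinearMap.range_eq_top]
  apply Submodule.eq_top_of_finrank_eq
  have h1 := LinearMap.finrank_range_add_finrank_ker E
  have h2 := Submodule.finrank_le (LinearMap.range E)
  simp only [Module.finrank_fintype_fun_eq_card, Fintype.card_fin, Fintype.card_sigma] at h1 h2 ⊢
  omega

/-- Projecting solutions of the decoder's linear system to `σ` identifies the solution space with
the space of the `σ` for which `σ(e)` lies in the interleaved code of dimension `s(k + t)`. -/
theorem exists_mem_solutionSpace_iff [FiniteDimensional K F] (hδ : IsDerivation θ δ)
    (hθK : ∀ x : K, θ (algebraMap K F x) = algebraMap K F x)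
    (hδK : ∀ x : K, δ (algebraMap K F x) = 0)
    {ℓ s : ℕ} {n : Fin ℓ → ℕ} {k t : ℕ} {ξ : Fin ℓ → F} {β : Fin s → (Σ i, Fin (n i)) → F}
    {f : Fin s → F[X]} (hf : ∀ j, (f j).degree < k) (e : (Σ i, Fin (n i)) × Fin s → F)
    (w : Fin (t + 1) → F) :
    (∃ v ∈ solutionSpace θ δ ξ β k t (hilrsEncode θ δ ξ β f + e), v ∘ Sum.inr = w) ↔
      (fun x => opEval θ δ (polyOf w) (e x) (ξ x.1.1)) ∈ hilrsCode θ δ ξ β (k + t) := by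
  have hy : ∀ p j, opEval θ δ (polyOf w) ((hilrsEncode θ δ ξ β f + e) (p, j)) (ξ p.1) =
      opEval θ δ (skewMul θ δ (polyOf w) (f j)) (β j p) (ξ p.1) +
        opEval θ δ (polyOf w) (e (p, j)) (ξ p.1) := by
    intro p j
    rw [Pi.add_apply, opEval_add_right hδ hθK hδK, opEval_skewMul θ hδ]
    rfl
  have hd : ∀ j, (skewMul θ δ (polyOf w) (f j)).degree < ((t + k : ℕ) : WithBot ℕ) := fun j =>
    degree_skewMul_lt (degree_polyOf_lt w) (hf j)
  constructor
  · rintro ⟨v, hv, rfl⟩ j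
    -- By the key equation, `p_j - σ f_j` takes the values `σ(e_j)` at the locators; conversely,
    -- `p_j` is recovered as `σ f_j + g_j`.
    refine ⟨solP v j - skewMul θ δ (polyOf (v ∘ Sum.inr)) (f j), ?_, ?_⟩
    · rw [add_comm k t]
      exact (degree_sub_le _ _).trans_lt (max_lt (degree_polyOf_lt _) (hd j))
    · ext p
      have h1 := (mem_solutionSpace θ δ).mp hv p j
      change _ = opEval θ δ (polyOf (v ∘ Sum.inr)) _ _ at h1
      rw [hy] at h1
      change opEval θ δ (polyOf (v ∘ Sum.inr)) (e (p, j)) (ξ p.1) = opEval θ δ _ _ _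
      rw [opEval_sub, h1, add_sub_cancel_left]
  · intro h
    choose g hg hge using h
    rw [add_comm k t] at hg
    refine ⟨Sum.elim (fun x => (skewMul θ δ (polyOf w) (f x.2) + g x.2).coeff x.1) w, ?_, rfl⟩
    rw [mem_solutionSpace]
    intro p j
    have h1 : solP (Sum.elim
        (fun x : Fin (t + k) × Fin s => (skewMul θ δ (polyOf w) (f x.2) + g x.2).coeff x.1) w) j =
        skewMul θ δ (polyOf w) (f j) + g j :=
      polyOf_coeff ((degree_add_le _ _).trans_lt (max_lt (hd j) (hg j)))
    rw [h1, opEval_add_left]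
    change _ = opEval θ δ (polyOf w) _ _
    rw [hy, add_right_inj]
    exact (congrFun (hge j) p).symm

variable [FiniteDimensional K F] {ℓ s : ℕ} {n : Fin ℓ → ℕ} {k t : ℕ} {ξ : Fin ℓ → F}
  {β : Fin s → (Σ i, Fin (n i)) → F}

/-- A polynomial of degree less than `t + k ≤ n` is determined by its values at the locators. -/
theorem eq_of_opEval_locators_eq (hδ : IsDerivation θ δ)
    (hθK : ∀ x : K, θ (algebraMap K F x) = algebraMap K F x)
    (hδK : ∀ x : K, δ (algebraMap K F x) = 0)
    (hξ : ∀ i i', i ≠ i' → ¬ Conj θ δ (ξ i) (ξ i'))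
    (hξ' : ∀ i, centralizer θ δ (ξ i) = Set.range (algebraMap K F))
    (hβ : ∀ j i, LinearIndependent K fun p : Fin (n i) => β j ⟨i, p⟩)
    (ht : t + k ≤ ∑ i, n i) {p q : F[X]} (hp : p.degree < ((t + k : ℕ) : WithBot ℕ))
    (hq : q.degree < ((t + k : ℕ) : WithBot ℕ)) (j : Fin s)
    (h : ∀ x, opEval θ δ p (β j x) (ξ x.1) = opEval θ δ q (β j x) (ξ x.1)) : p = q := by
  refine sub_eq_zero.mp (eq_zero_of_opEval_eq_zero hδ hθK hδK hξ hξ' (hβ j) ?_ fun x => ?_)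
  · exact ((degree_sub_le _ _).trans_lt (max_lt hp hq)).trans_le (by exact_mod_cast ht)
  · rw [opEval_sub, h, sub_self]

/-- A solution of the linear system with `σ = 0` vanishes. -/
theorem eq_zero_of_mem_solutionSpace (hδ : IsDerivation θ δ)
    (hθK : ∀ x : K, θ (algebraMap K F x) = algebraMap K F x)
    (hδK : ∀ x : K, δ (algebraMap K F x) = 0)
    (hξ : ∀ i i', i ≠ i' → ¬ Conj θ δ (ξ i) (ξ i'))
    (hξ' : ∀ i, centralizer θ δ (ξ i) = Set.range (algebraMap K F))
    (hβ : ∀ j i, LinearIndependent K fun p : Fin (n i) => β j ⟨i, p⟩)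
    (ht : t + k ≤ ∑ i, n i) {y : (Σ i, Fin (n i)) × Fin s → F}
    {v : (Fin (t + k) × Fin s) ⊕ Fin (t + 1) → F} (hv : v ∈ solutionSpace θ δ ξ β k t y)
    (h0 : v ∘ Sum.inr = 0) : v = 0 := by
  have hσ : solSigma v = 0 := polyOf_eq_zero.mpr h0
  rw [mem_solutionSpace] at hv
  ext x
  rcases x with ⟨i, j⟩ | i
  · have h1 : solP v j = 0 := by
      refine eq_of_opEval_locators_eq hδ hθK hδK hξ hξ' hβ ht (degree_polyOf_lt _)
        (by simp) j fun p => ?_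
      rw [hv p j, hσ, opEval_zero_left, opEval_zero_left]
    exact congrFun (polyOf_eq_zero.mp h1) i
  · exact congrFun h0 i

/-- With a solution `v ≠ 0` for which `σ(e) = 0`, the decoder returns the sent polynomials. -/
theorem decoderReturns_iff (hδ : IsDerivation θ δ)
    (hθK : ∀ x : K, θ (algebraMap K F x) = algebraMap K F x)
    (hδK : ∀ x : K, δ (algebraMap K F x) = 0)
    (hξ : ∀ i i', i ≠ i' → ¬ Conj θ δ (ξ i) (ξ i'))
    (hξ' : ∀ i, centralizer θ δ (ξ i) = Set.range (algebraMap K F))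
    (hβ : ∀ j i, LinearIndependent K fun p : Fin (n i) => β j ⟨i, p⟩)
    (ht : t + k ≤ ∑ i, n i) {f : Fin s → F[X]} (hf : ∀ j, (f j).degree < k)
    {e : (Σ i, Fin (n i)) × Fin s → F} {v : (Fin (t + k) × Fin s) ⊕ Fin (t + 1) → F}
    (hv : v ∈ solutionSpace θ δ ξ β k t (hilrsEncode θ δ ξ β f + e)) (hv0 : v ≠ 0)
    (he : ∀ x, opEval θ δ (solSigma v) (e x) (ξ x.1.1) = 0) (out : Option (Fin s → F[X])) :
    DecoderReturns θ δ k v out ↔ out = some f := by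
  -- A nonzero divisor is needed for `0` to be an admissible remainder.
  have hσ : solSigma v ≠ 0 := fun h => hv0
    (eq_zero_of_mem_solutionSpace hδ hθK hδK hξ hξ' hβ ht hv (polyOf_eq_zero.mp h))
  have hP : ∀ j, solP v j = skewMul θ δ (solSigma v) (f j) := by
    intro j
    refine eq_of_opEval_locators_eq hδ hθK hδK hξ hξ' hβ ht (degree_polyOf_lt _)
      (degree_skewMul_lt (degree_polyOf_lt _) (hf j)) j fun p => ?_
    rw [(mem_solutionSpace θ δ).mp hv p j, Pi.add_apply, opEval_add_right hδ hθK hδK, he (p, j),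
      add_zero, opEval_skewMul θ hδ]
    rfl
  have hdiv : ∀ j, IsLeftDivision θ δ (solP v j) (solSigma v) (f j) 0 := fun j =>
    ⟨by rw [hP, add_zero], by rw [degree_zero]; exact bot_lt_iff_ne_bot.mpr (by simpa using hσ)⟩
  constructor
  · rintro ⟨u, r, hur, h⟩
    have hu : u = f := funext fun j => ((hur j).unique θ (hdiv j)).1
    have hr : ∀ j, r j = 0 := fun j => ((hur j).unique θ (hdiv j)).2
    subst hu
    rcases h with ⟨⟨j, hj⟩, -⟩ | ⟨-, h⟩
    · exact absurd hj (not_or.mpr ⟨not_not.mpr (hr j), not_le.mpr (hf j)⟩)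
    · exact h
  · rintro rfl
    exact ⟨f, fun _ => 0, hdiv, Or.inr ⟨fun j => ⟨rfl, hf j⟩, rfl⟩⟩

/-- The coordinates of the solution space: `σ` ranges over the kernel of
`σ ↦ σ(a) B Hᵀ`. -/
theorem map_solutionSpace_eq_ker (hδ : IsDerivation θ δ)
    (hθK : ∀ x : K, θ (algebraMap K F x) = algebraMap K F x)
    (hδK : ∀ x : K, δ (algebraMap K F x) = 0) {f : Fin s → F[X]} (hf : ∀ j, (f j).degree < k)
    {τ : Fin ℓ → ℕ} (a : (Σ i, Fin (τ i)) → F)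
    (B : Fin s → ∀ i, Matrix (Fin (τ i)) (Fin (n i)) K)
    {ρ : Type*} (H : Matrix ρ ((Σ i, Fin (n i)) × Fin s) F)
    (hH : IsParityCheck H (hilrsCode θ δ ξ β (k + t))) :
    (solutionSpace θ δ ξ β k t (hilrsEncode θ δ ξ β f +
        Matrix.vecMul a ((errMatrix B).map (algebraMap K F)))).map
      (LinearMap.funLeft F F (Sum.inr : Fin (t + 1) → (Fin (t + k) × Fin s) ⊕ Fin (t + 1))) =
    LinearMap.ker (((errMatrix B).map (algebraMap K F) * H.transpose).transpose.mulVecLin ∘ₗ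
      multiEval θ δ (t + 1) ξ Sigma.fst a) := by
  ext w
  rw [Submodule.mem_map, LinearMap.mem_ker, LinearMap.comp_apply, Matrix.mulVecLin_apply,
    Matrix.mulVec_transpose, ← Matrix.vecMul_vecMul, Matrix.vecMul_transpose, ← hH.2]
  refine (exists_mem_solutionSpace_iff hδ hθK hδK hf _ w).trans ?_
  simp only [opEval_vecMul_errMatrix hδ hθK hδK]
  rfl

end Decoding

end HILRS

theorem lemma1 {K F : Type*} [Field K] [Field F] [Finite F] [Algebra K F]
    -- the automorphism, with fixed field `K`, and the derivation
    (θ : F ≃+* F) (hθ : ∀ x : F, θ x = x ↔ x ∈ Set.range (algebraMap K F))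
    (δ : F →+ F) (hδ : HILRS.IsDerivation θ δ)
    -- the code parameters
    {ℓ s : ℕ} (hs : 0 < s) (n : Fin ℓ → ℕ) (hn : ∀ i, 0 < n i) (k : ℕ)
    (ξ : Fin ℓ → F)
    (hξ : ∀ i i', i ≠ i' → ¬ HILRS.Conj θ δ (ξ i) (ξ i'))
    (hξ' : ∀ i, HILRS.centralizer θ δ (ξ i) = Set.range (algebraMap K F))
    (β : Fin s → (Σ i, Fin (n i)) → F)
    (hβ : ∀ j i, LinearIndependent K fun p : Fin (n i) => β j ⟨i, p⟩)
    -- the transmitted codeword, the error and the received vector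
    (f : Fin s → F[X]) (hf : ∀ j, (f j).degree < k)
    (c e y : (Σ i, Fin (n i)) × Fin s → F)
    (hc : c = HILRS.hilrsEncode θ δ ξ β f) (hy : y = c + e)
    (t : ℕ) (he : HILRS.sumRankWeight K e = t) (ht : t + k ≤ ∑ i, n i)
    (τ : Fin ℓ → ℕ) (a : (Σ i, Fin (τ i)) → F)
    (B : Fin s → ∀ i, Matrix (Fin (τ i)) (Fin (n i)) K)
    (hB : HILRS.IsErrorDecomposition e τ a B)
    -- a parity-check matrix of the interleaved code with `k + t` in place of `k`
    {ρ : Type*} [Fintype ρ] (H : Matrix ρ ((Σ i, Fin (n i)) × Fin s) F)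
    (hH : HILRS.IsParityCheck H (HILRS.hilrsCode θ δ ξ β (k + t))) :
    ((HILRS.gaoMatrix θ δ ξ β k t y).rank = (s + 1) * t + s * k ↔
      ((HILRS.errMatrix B).map (algebraMap K F) * H.transpose).rank = t) ∧
    ((HILRS.gaoMatrix θ δ ξ β k t y).rank = (s + 1) * t + s * k ↔
      Module.finrank F (HILRS.solutionSpace θ δ ξ β k t y) = 1) ∧
    ((HILRS.gaoMatrix θ δ ξ β k t y).rank = (s + 1) * t + s * k →
      ∀ v ∈ HILRS.solutionSpace θ δ ξ β k t y, v ≠ 0 →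
        ∀ out : Option (Fin s → F[X]),
          HILRS.DecoderReturns θ δ k v out ↔ out = some f) := by
  have hθK : ∀ x : K, θ (algebraMap K F x) = algebraMap K F x := fun x => (hθ _).mpr ⟨x, rfl⟩
  have hδK : ∀ x : K, δ (algebraMap K F x) = 0 := hδ.apply_algebraMap_eq_zero hθK
  have : FiniteDimensional K F := Module.Finite.of_finite
  obtain rfl := hc
  obtain rfl := hy
  have hτ : ∑ i, τ i = t := by
    rw [← he, HILRS.sumRankWeight]
    exact Finset.sum_congr rfl fun i _ => hB.rank_eq i
  have heq := hB.eq_mul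
  subst heq
  set e := Matrix.vecMul a ((HILRS.errMatrix B).map (algebraMap K F)) with he_def
  set y := HILRS.hilrsEncode θ δ ξ β f + e
  set N := (HILRS.errMatrix B).map (algebraMap K F) * H.transpose with hN
  set E := HILRS.multiEval θ δ (t + 1) ξ Sigma.fst a with hE
  have hEs : Function.Surjective E :=
    HILRS.multiEval_surjective hδ hθK hδK hξ hξ' hB.indep_a hτ
  have hmap := HILRS.map_solutionSpace_eq_ker hδ hθK hδK hf a B H hH
  -- Rank-nullity for `Nᵀ ∘ E` on `F^(t+1)`: surjectivity of `E` keeps the rank of `N`, and the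
  -- kernel is the injective projection of the solution space to `σ`.
  have hfin : Module.finrank F (HILRS.solutionSpace θ δ ξ β k t y) + N.rank = t + 1 := by
    have h1 := LinearMap.finrank_range_add_finrank_ker (N.transpose.mulVecLin ∘ₗ E)
    rw [← hmap, LinearMap.range_comp_of_range_eq_top _ (LinearMap.range_eq_top.mpr hEs),
      ← Matrix.rank, Matrix.rank_transpose, Module.finrank_fintype_fun_eq_card,
      Fintype.card_fin] at h1
    have h2 := LinearMap.finrank_range_of_inj
      (f := (LinearMap.funLeft F F (Sum.inr : Fin (t + 1) → _)).domRestrict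
        (HILRS.solutionSpace θ δ ξ β k t y)) (by
      rw [injective_iff_map_eq_zero]
      rintro ⟨v, hv⟩ h0
      ext1
      exact HILRS.eq_zero_of_mem_solutionSpace hδ hθK hδK hξ hξ' hβ ht hv h0)
    rw [LinearMap.range_domRestrict] at h2
    rw [← h2, add_comm]
    exact h1
  have hNle : N.rank ≤ t := by
    have := N.rank_le_card_height
    simpa [Fintype.card_sigma, hτ] using this
  have hM : (HILRS.gaoMatrix θ δ ξ β k t y).rank +
      Module.finrank F (HILRS.solutionSpace θ δ ξ β k t y) = (s + 1) * t + s * k + 1 := by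
    rw [HILRS.gaoMatrix, Matrix.rank_transpose]
    refine (LinearMap.finrank_range_add_finrank_ker _).trans ?_
    simp only [Module.finrank_fintype_fun_eq_card, Fintype.card_sum, Fintype.card_prod,
      Fintype.card_fin]
    ring
  -- `hfin` and `hM` make each of the three conditions equivalent to a one-dimensional solution
  -- space.
  refine ⟨by omega, by omega, fun hr v hv hv0 out => ?_⟩
  refine HILRS.decoderReturns_iff hδ hθK hδK hξ hξ' hβ ht hf hv hv0 (fun x => ?_) out
  -- The rank condition forces `N.rank = t`, which is full column rank for `Nᵀ`; hence `σ(a) B Hᵀ =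
  -- 0` implies `σ(a) = 0`.
  have hinj : Function.Injective N.transpose.mulVecLin := by
    rw [← LinearMap.ker_eq_bot, ← Submodule.finrank_eq_zero (R := F)]
    have h1 := LinearMap.finrank_range_add_finrank_ker N.transpose.mulVecLin
    rw [← Matrix.rank, Matrix.rank_transpose, Module.finrank_fintype_fun_eq_card,
      Fintype.card_sigma] at h1
    simp only [Fintype.card_fin] at h1
    omega
  have hv' : v ∘ Sum.inr ∈ LinearMap.ker (N.transpose.mulVecLin ∘ₗ E) := by
    rw [← hmap]
    exact ⟨v, hv, rfl⟩
  have hEv : E (v ∘ Sum.inr) = 0 := hinj ((LinearMap.mem_ker.mp hv').trans (map_zero _).symm)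
  rw [he_def, HILRS.opEval_vecMul_errMatrix hδ hθK hδK]
  change Matrix.vecMul (E (v ∘ Sum.inr)) _ x = 0
  rw [hEv, Matrix.zero_vecMul, Pi.zero_apply]
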